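/- **Setting.** Let $\mathcal X\subset\mathbb R^{d}$ be a finite set of inputs. For every number of qubits $m$ consider a parameterized quantum circuit on $m$ qubits with $L=L(m)$ layers, $U(\Theta,x)=U_L(\Theta,x)\cdots U_1(\Theta,x)$. The layer $U_\ell=V_\ell(x)W_\ell(\Theta)$ consists of the parameterized gates $W_\ell(\Theta)=\bigotimes_{k=1}^m e^{-i\theta_{\ell,k}\mathcal G_{\ell,k}}$, where each $\mathcal G_{\ell,k}$ is a Hermitian $2\times2$ matrix with spectrum $\{-1,+1\}$ and each gate has its own real parameter $\theta_{\ell,k}$, followed by $V_\ell(x)$, a tensor product of arbitrary one-qubit and two-qubit unitary gates acting on disjoint sets of qubits, which may depend on $x$. The assignment of these gates to qubits does not depend on $x$. For each $k$ let $O_k$ be a Hermitian $2\times 2$ matrix with $\mathrm{Tr}\,O_k=0$ and spectrum in $[-1,1]$, let $\mathcal O_k$ be $O_k$ acting on qubit $k$, and put $$f^{(m)}_k(\Theta,x)=\langle 0^m|U^\dagger(\Theta,x)\,\mathcal O_k\,U(\Theta,x)|0^m\rangle,\qquad f^{(m)}(\Theta,x)=\frac1{N(m)}\sum_{k=1}^m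 f^{(m)}_k(\Theta,x),$$ where $N(m)>0$ is a normalization constant. **Light cones.** Let $\mathcal I_{\ell,k}$ be the set consisting of $k$ and of the qubit (if any) that shares a two-qubit gate of $V_\ell$ with $k$. Put $\mathcal J^L_k=\mathcal I_{L,k}$ and $\mathcal J^\ell_k=\bigcup_{k'\in\mathcal J^{\ell+1}_k}\mathcal I_{\ell,k'}$ for $\ell<L$. The past light cone of the observable $k$ is $\mathcal N_k=\{(\ell,k'):k'\in\mathcal J^\ell_k\}$ and the future light cone of the parameter $(\ell,k')$ is $\mathcal M_{(\ell,k')}=\{k:(\ell,k')\in\mathcal N_k\}$. Let $|\mathcal N|=\max_k|\mathcal N_k|$ and $|\mathcal M|=\max_{i}|\mathcal M_{i}|$ over all parameter indices $i$; both depend on $m$. **Theorem 3.6 (Gaussian process at initialization).** Suppose that, for every $m$, the parameters $\theta_{\ell,k}$ are independent (not necessarily identically distributed) real random variables such that $\mathbb E[f^{(m)}_k(\Theta,x)]=0$ for all $k$ and all $x\in\mathcal X$. Suppose that there is a function $\mathcal K:\mathcal X\times\mathcal X\to\mathbb R$ with $\mathcal K(x,x)>0$ for all $x\in\mathcal X$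 and $$\lim_{m\to\infty}\ \sup_{x,x'\in\mathcal X}\Big|\mathbb E\big[f^{(m)}(\Theta,x)f^{(m)}(\Theta,x')\big]-\mathcal K(x,x')\Big|=0,$$ and that $$\lim_{m\to\infty}\frac{m\,|\mathcal M|^2|\mathcal N|^2}{N(m)^3}=0 .$$ Then there is a Gaussian process $\{f^{(\infty)}(x)\}_{x\in\mathcal X}$ with mean zero and covariance function $\mathcal K$ such that, as $m\to\infty$, $f^{(m)}(\Theta,\cdot)$ converges in distribution to $f^{(\infty)}\sim GP(0,\mathcal K)$, as random elements of $\mathbb R^{\mathcal X}$. -/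

import Mathlib

open MeasureTheory ProbabilityTheory Filter Topology
open scoped Matrix

noncomputable section

/-- Operators on the Hilbert space of `m` qubits, as matrices in the computational basis, which is
indexed by the bit strings `Fin m → Fin 2`. -/
abbrev QubitOp (m : ℕ) : Type := Matrix (Fin m → Fin 2) (Fin m → Fin 2) ℂ

/-- The operator `1 ⊗ ⋯ ⊗ 1 ⊗ A ⊗ 1 ⊗ ⋯ ⊗ 1`, with the single-qubit operator `A` acting on the
qubit `k`. -/
def onQubit {m : ℕ} (k : Fin m) (A : Matrix (Fin 2) (Fin 2) ℂ) : QubitOp m :=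
  fun a b => if ∀ j, j ≠ k → a j = b j then A (a k) (b k) else 0

/-- A parameterized quantum circuit with inputs in `𝒳`, acting on `m` qubits and measured by a sum
of single-qubit observables. Each layer consists of one parameterized single-qubit gate per qubit,
followed by one-qubit and two-qubit gates on disjoint qubits, which may depend on the input. -/
structure QuantumCircuit (𝒳 : Type*) (m : ℕ) where
  /-- the number `L` of layers -/
  depth : ℕ
  /-- the generator of the parameterized gate on the qubit `k` in the layer `ℓ` -/
  gen : Fin depth → Fin m → Matrix (Fin 2) (Fin 2) ℂ
  gen_isHermitian : ∀ ℓ k, (gen ℓ k).IsHermitian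
  gen_spectrum : ∀ ℓ k, spectrum ℝ (gen ℓ k) = {-1, 1}
  /-- The qubits are divided into the pairs that interact in the layer `ℓ` and the singletons of
  the qubits which do not interact with any other qubit in that layer. -/
  blocks : Fin depth → Finpartition (Finset.univ : Finset (Fin m))
  card_le_two : ∀ ℓ, ∀ E ∈ (blocks ℓ).parts, E.card ≤ 2
  /-- The unitary gate acting on the qubits of the block `E` in the layer `ℓ`, for the input `x`
  (only the values at the blocks of the layer are used). -/
  gate : Fin depth → (E : Finset (Fin m)) → 𝒳 → Matrix.unitaryGroup (E → Fin 2) ℂ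
  /-- the observable measured on the qubit `k` -/
  obs : Fin m → Matrix (Fin 2) (Fin 2) ℂ
  obs_isHermitian : ∀ k, (obs k).IsHermitian
  obs_trace : ∀ k, (obs k).trace = 0
  obs_spectrum : ∀ k, spectrum ℝ (obs k) ⊆ Set.Icc (-1) 1

namespace QuantumCircuit

variable {𝒳 : Type*} {m : ℕ} (C : QuantumCircuit 𝒳 m)

/-- The indices of the parameters: `(ℓ, k)` is the index of the parameter of the gate acting on the
qubit `k` in the layer `ℓ`. -/
abbrev Param : Type := Fin C.depth × Fin m

/-- The parameterized single-qubit gate `exp (-i t G)`. -/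
def paramGate (i : C.Param) (t : ℝ) : Matrix (Fin 2) (Fin 2) ℂ :=
  NormedSpace.exp ((-(Complex.I * (t : ℂ))) • C.gen i.1 i.2)

/-- The tensor product over all the qubits of the parameterized gates of the layer `ℓ`. -/
def paramLayer (ℓ : Fin C.depth) (θ : C.Param → ℝ) : QubitOp m :=
  fun a b => ∏ k, C.paramGate (ℓ, k) (θ (ℓ, k)) (a k) (b k)

/-- The tensor product of the input-dependent one-qubit and two-qubit gates of the layer `ℓ`. -/
def inputLayer (ℓ : Fin C.depth) (x : 𝒳) : QubitOp m :=
  fun a b => ∏ E ∈ (C.blocks ℓ).parts,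
    (C.gate ℓ E x : Matrix (E → Fin 2) (E → Fin 2) ℂ) (fun j => a j) (fun j => b j)

/-- The unitary `U_L ⋯ U_2 U_1`, where `U_ℓ` is the `ℓ`-th layer of the circuit. -/
def unitary (θ : C.Param → ℝ) (x : 𝒳) : QubitOp m :=
  Fin.induction (motive := fun _ => QubitOp m) 1
    (fun ℓ U => (C.inputLayer ℓ x * C.paramLayer ℓ θ) * U) (Fin.last C.depth)

/-- The expectation `⟨0^m| U† A U |0^m⟩` of the observable `A` in the output state of the circuit
(a real number if `A` is Hermitian). -/
def expval (A : QubitOp m) (θ : C.Param → ℝ) (x : 𝒳) : ℝ :=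
  (((C.unitary θ x)ᴴ * A * C.unitary θ x) (fun _ => 0) (fun _ => 0)).re

/-- The local output `f_k`. -/
def localOutput (k : Fin m) (θ : C.Param → ℝ) (x : 𝒳) : ℝ :=
  C.expval (onQubit k (C.obs k)) θ x

/-- The function `f` generated by the circuit, with normalization `N`. -/
def model (N : ℝ) (θ : C.Param → ℝ) (x : 𝒳) : ℝ :=
  (1 / N) * C.expval (∑ k, onQubit k (C.obs k)) θ x

theorem model_eq_sum (N : ℝ) (θ : C.Param → ℝ) (x : 𝒳) :
    C.model N θ x = (1 / N) * ∑ k, C.localOutput k θ x := by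
  simp [model, localOutput, expval, Finset.mul_sum, Finset.sum_mul, Matrix.sum_apply]

/-- The set of the qubits that interact with the qubit `k` in the layer `ℓ`, together with `k`. -/
def interacting (ℓ : Fin C.depth) (k : Fin m) : Finset (Fin m) := (C.blocks ℓ).part k

/-- The past cone of the qubit `k`, followed backwards from the end of the circuit. The value at
`Fin.last L` is `{k}`, and the value at `ℓ.castSucc` is the set of the qubits whose state before the
input-dependent gates of the layer `ℓ` may influence the measurement of the qubit `k`. -/
def cone (k : Fin m) (ℓ : Fin (C.depth + 1)) : Finset (Fin m) :=
  Fin.reverseInduction (motive := fun _ => Finset (Fin m)) {k}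
    (fun ℓ J => J.biUnion (C.interacting ℓ)) ℓ

theorem cone_last (k : Fin m) : C.cone k (Fin.last C.depth) = {k} := by
  simp [cone]

theorem cone_castSucc (k : Fin m) (ℓ : Fin C.depth) :
    C.cone k ℓ.castSucc = (C.cone k ℓ.succ).biUnion (C.interacting ℓ) := by
  simp [cone]

/-- The (extended) past light cone `𝒩_k` of the observable on the qubit `k`. -/
def pastCone (k : Fin m) : Finset C.Param :=
  Finset.univ.filter fun i => i.2 ∈ C.cone k i.1.castSucc

/-- The (extended) future light cone `ℳ_i` of the parameter `i`. -/
def futureCone (i : C.Param) : Finset (Fin m) :=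
  Finset.univ.filter fun k => i ∈ C.pastCone k

/-- The maximal cardinality `|𝒩|` of the past light cones. -/
def maxPast : ℕ := Finset.univ.sup fun k => (C.pastCone k).card

/-- The maximal cardinality `|ℳ|` of the future light cones. -/
def maxFuture : ℕ := Finset.univ.sup fun i => (C.futureCone i).card

end QuantumCircuit

/-- `G` is a Gaussian process with mean function `μ` and covariance function `K`. -/
structure IsGaussianProcessWith {T Ω : Type*} [MeasurableSpace Ω] (μ : T → ℝ) (K : T → T → ℝ)
    (G : T → Ω → ℝ) (P : Measure Ω) : Prop where
  isGaussianProcess : IsGaussianProcess G P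
  mean_eq : ∀ t, ∫ ω, G t ω ∂P = μ t
  covariance_eq : ∀ s t, covariance (G s) (G t) P = K s t

end

/-! The theorem is a central limit theorem for bounded, locally dependent variables. Pulled back
through the layers (Heisenberg picture), the observable on qubit `k` acts only on its past cone: the
gates outside the cone commute with it and cancel against their adjoints (`conj_tensorLayer`,
`exists_heisenberg`). Hence f_k is a function of the parameters in 𝒩_k alone (`localOutput_congr`),
and outputs with disjoint past cones are independent. At most D = |𝒩||ℳ| outputs share a parameter
with a given one (`card_neighbors_le`), and |f_k| ≤ 1 (`abs_localOutput_le_one`).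

For fixed u, the combination Σ_x u_x f(x) is a sum over k of m centred variables bounded by B = Σ_x
|u_x| / N. Its characteristic function φ almost satisfies the Gaussian equation φ' = -t v φ, where v
is the variance: in E[X_k exp(itW)], removing the neighbours of k from W gives zero at order zero,
and the first-order term decouples up to a small error (`norm_integral_mul_exp_sum_sub_le`).
Integrating over [0, 1] bounds the distance to exp(-v/2) by 7 m D² B³ (`norm_charFun_sum_sub_le`),
which for fixed u is a multiple of the quantity assumed to vanish.

The second moments converge to the quadratic form of 𝒦, which is therefore positive semidefinite and
is the covariance of a Gaussian vector. Lévy's continuity theorem concludes. -/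

/-! ### Tensor products of matrices -/

section PiTensor

variable {ι : Type*} [Fintype ι] {β : ι → Type*}

/-- The tensor product of a family of matrices. -/
def piTensor (M : ∀ i, Matrix (β i) (β i) ℂ) : Matrix (∀ i, β i) (∀ i, β i) ℂ :=
  fun a b => ∏ i, M i (a i) (b i)

theorem piTensor_mul [DecidableEq ι] [∀ i, Fintype (β i)] (M M' : ∀ i, Matrix (β i) (β i) ℂ) :
    piTensor M * piTensor M' = piTensor fun i => M i * M' i := by
  ext a b
  simp only [piTensor, Matrix.mul_apply, Finset.prod_univ_sum, Fintype.piFinset_univ,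
    Finset.prod_mul_distrib]

theorem piTensor_one [∀ i, DecidableEq (β i)] :
    piTensor (fun i => (1 : Matrix (β i) (β i) ℂ)) = 1 := by
  ext a b
  by_cases h : a = b
  · subst h; simp [piTensor]
  · obtain ⟨i, hi⟩ := Function.ne_iff.1 h
    rw [Matrix.one_apply_ne h]
    exact Finset.prod_eq_zero (Finset.mem_univ i) (Matrix.one_apply_ne hi)

theorem conjTranspose_piTensor (M : ∀ i, Matrix (β i) (β i) ℂ) :
    (piTensor M)ᴴ = piTensor fun i => (M i)ᴴ := by
  ext a b
  simp [piTensor, Matrix.conjTranspose_apply]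

end PiTensor

/-! ### Operators acting on a subset of the qubits -/

section LocalOn

variable {m : ℕ}

/-- The operator `A` acts as the identity on the qubits outside of `S`: it is of the form
`A' ⊗ 1`, where `A'` acts on the qubits in `S`. -/
structure LocalOn (S : Finset (Fin m)) (A : QubitOp m) : Prop where
  diag : ∀ a b, A a b ≠ 0 → ∀ j ∉ S, a j = b j
  -- Addition in `Fin 2` is modulo 2, so `d` flips bits outside `S`. Invariance under simultaneous
  -- flips in row and column is what makes the tensor factor outside `S` the identity rather than
  -- just diagonal.
  translate : ∀ d : Fin m → Fin 2, (∀ j ∈ S, d j = 0) → ∀ a b, A (a + d) (b + d) = A a b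

theorem LocalOn.mono {S T : Finset (Fin m)} {A : QubitOp m} (h : LocalOn S A) (hST : S ⊆ T) :
    LocalOn T A :=
  ⟨fun a b hab j hj => h.diag a b hab j fun hS => hj (hST hS),
    fun d hd => h.translate d fun j hj => hd j (hST hj)⟩

theorem LocalOn.conjTranspose {S : Finset (Fin m)} {A : QubitOp m} (h : LocalOn S A) :
    LocalOn S Aᴴ :=
  ⟨fun a b hab j hj => (h.diag b a (fun h0 => hab (by simp [h0])) j hj).symm,
    fun d hd a b => by simp [h.translate d hd]⟩

theorem LocalOn.mul {S : Finset (Fin m)} {A B : QubitOp m} (hA : LocalOn S A) (hB : LocalOn S B) :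
    LocalOn S (A * B) := by
  refine ⟨fun a b hab j hj => ?_, fun d hd a b => ?_⟩
  · rw [Matrix.mul_apply] at hab
    obtain ⟨c, -, hc⟩ := Finset.exists_ne_zero_of_sum_ne_zero hab
    exact (hA.diag a c (left_ne_zero_of_mul hc) j hj).trans
      (hB.diag c b (right_ne_zero_of_mul hc) j hj)
  · rw [Matrix.mul_apply, Matrix.mul_apply,
      ← Equiv.sum_comp (Equiv.addRight d) fun c => A (a + d) c * B c (b + d)]
    exact Finset.sum_congr rfl fun c _ => by
      simp [hA.translate d hd, hB.translate d hd]

/-- `A` changes only bits in `S` and `B` only bits outside, so each entry of either product has a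
single contributing intermediate string, a mixture of `a` and `b`. Translation invariance identifies
the factors of the two products. -/
theorem LocalOn.commute_compl {S : Finset (Fin m)} {A B : QubitOp m} (hA : LocalOn S A)
    (hB : LocalOn Sᶜ B) : A * B = B * A := by
  ext a b
  have hAB : (A * B) a b = A a (S.piecewise b a) * B (S.piecewise b a) b := by
    rw [Matrix.mul_apply]
    refine Finset.sum_eq_single _ (fun c _ hc => ?_) (by simp)
    by_contra h
    refine hc (funext fun j => ?_)
    by_cases hj : j ∈ S
    · simpa [hj] using hB.diag c b (right_ne_zero_of_mul h) j (by simpa using hj)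
    · simpa [hj] using (hA.diag a c (left_ne_zero_of_mul h) j hj).symm
  have hBA : (B * A) a b = B a (S.piecewise a b) * A (S.piecewise a b) b := by
    rw [Matrix.mul_apply]
    refine Finset.sum_eq_single _ (fun c _ hc => ?_) (by simp)
    by_contra h
    refine hc (funext fun j => ?_)
    by_cases hj : j ∈ S
    · simpa [hj] using (hB.diag a c (left_ne_zero_of_mul h) j (by simpa using hj)).symm
    · simpa [hj] using hA.diag c b (right_ne_zero_of_mul h) j hj
  -- The shift vanishes on `S`. It carries `a` to `S.piecewise a b` and `S.piecewise b a` to `b`.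
  have h1 := hA.translate (S.piecewise a b - a) (fun j hj => by simp [hj]) a (S.piecewise b a)
  have h2 := hB.translate (S.piecewise b a - a)
    (fun j hj => by simp [Finset.mem_compl.1 hj]) a (S.piecewise a b)
  have e1 : S.piecewise b a + (S.piecewise a b - a) = b := by
    ext j; by_cases hj : j ∈ S <;> simp [hj]
  have e2 : S.piecewise a b + (S.piecewise b a - a) = b := by
    ext j; by_cases hj : j ∈ S <;> simp [hj]
  rw [add_sub_cancel, e1] at h1
  rw [add_sub_cancel, e2] at h2
  rw [hAB, hBA, h1, h2, mul_comm]

end LocalOn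

/-! ### Conjugation of local operators by a layer of gates -/

section TensorLayer

variable {m : ℕ} {ι : Type*} [Fintype ι] {β : ι → Type*} [∀ i, Fintype (β i)]
  [∀ i, DecidableEq (β i)] (e : (Fin m → Fin 2) ≃ ∀ i, β i)

/-- The operator on `m` qubits given by a tensor product of operators on groups of qubits, the
identification of the bit strings with the tuples of values on the groups being `e`. -/
def tensorLayer (M : ∀ i, Matrix (β i) (β i) ℂ) : QubitOp m := (piTensor M).submatrix e e

omit [∀ i, DecidableEq (β i)] in
theorem tensorLayer_mul [DecidableEq ι] (M M' : ∀ i, Matrix (β i) (β i) ℂ) :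
    tensorLayer e M * tensorLayer e M' = tensorLayer e fun i => M i * M' i := by
  rw [tensorLayer, tensorLayer, Matrix.submatrix_mul_equiv, piTensor_mul, tensorLayer]

omit [∀ i, Fintype (β i)] in
theorem tensorLayer_one : tensorLayer e (fun i => (1 : Matrix (β i) (β i) ℂ)) = 1 := by
  rw [tensorLayer, piTensor_one, Matrix.submatrix_one_equiv]

omit [∀ i, Fintype (β i)] [∀ i, DecidableEq (β i)] in
theorem conjTranspose_tensorLayer (M : ∀ i, Matrix (β i) (β i) ℂ) :
    (tensorLayer e M)ᴴ = tensorLayer e fun i => (M i)ᴴ := by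
  rw [tensorLayer, Matrix.conjTranspose_submatrix, conjTranspose_piTensor, tensorLayer]

theorem tensorLayer_unitary [DecidableEq ι] {M : ∀ i, Matrix (β i) (β i) ℂ}
    (hM : ∀ i, (M i)ᴴ * M i = 1) : (tensorLayer e M)ᴴ * tensorLayer e M = 1 := by
  rw [conjTranspose_tensorLayer, tensorLayer_mul, funext hM, tensorLayer_one]

omit [∀ i, Fintype (β i)] in
-- The map `q` sends a qubit to its group, and `he` says that the component `i` of `e a` records
-- exactly the bits of `a` in the group `i`. This covers both the parameterized gates (groups are
-- single qubits) and the input-dependent gates (groups are blocks).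
theorem localOn_tensorLayer {e : (Fin m → Fin 2) ≃ ∀ i, β i} {q : Fin m → ι}
    (he : ∀ a b i, e a i = e b i ↔ ∀ j, q j = i → a j = b j)
    {S : Finset (Fin m)} {M : ∀ i, Matrix (β i) (β i) ℂ}
    (hM : ∀ i, (∀ j, q j = i → j ∈ S) ∨ M i = 1) : LocalOn S (tensorLayer e M) := by
  refine ⟨fun a b hab j hj => ?_, fun d hd a b => Finset.prod_congr rfl fun i _ => ?_⟩
  · have h := Finset.prod_ne_zero_iff.1 hab (q j) (Finset.mem_univ _)
    rw [(hM (q j)).resolve_left fun h' => hj (h' j rfl)] at h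
    by_contra hne
    exact h (Matrix.one_apply_ne fun h' => hne ((he a b _).1 h' j rfl))
  · rcases hM i with h | h
    · have key : ∀ a, e (a + d) i = e a i := fun a =>
        (he _ _ _).2 fun j hj => by simp [hd j (h j hj)]
      rw [key, key]
    · have key : e (a + d) i = e (b + d) i ↔ e a i = e b i := by
        rw [he, he]; simp
      rw [h, Matrix.one_apply, Matrix.one_apply]
      simp only [key]

/-- The conjugation of an operator, local on a union `S` of groups of qubits, by a tensor product
of unitary operators depends only on the tensor factors acting on `S`. -/
theorem conj_tensorLayer [DecidableEq ι] {e : (Fin m → Fin 2) ≃ ∀ i, β i} {q : Fin m → ι}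
    (he : ∀ a b i, e a i = e b i ↔ ∀ j, q j = i → a j = b j)
    {S : Finset (Fin m)} (hS : ∀ j j', q j = q j' → j ∈ S → j' ∈ S)
    {M : ∀ i, Matrix (β i) (β i) ℂ} (hM : ∀ i, (M i)ᴴ * M i = 1) {H : QubitOp m}
    (hH : LocalOn S H) [DecidablePred fun i => ∀ j, q j = i → j ∈ S] :
    (tensorLayer e M)ᴴ * H * tensorLayer e M =
      (tensorLayer e fun i => if ∀ j, q j = i → j ∈ S then M i else 1)ᴴ * H *
        tensorLayer e fun i => if ∀ j, q j = i → j ∈ S then M i else 1 := by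
  set MS : ∀ i, Matrix (β i) (β i) ℂ := fun i => if ∀ j, q j = i → j ∈ S then M i else 1
  set MC : ∀ i, Matrix (β i) (β i) ℂ := fun i => if ∀ j, q j = i → j ∈ S then 1 else M i
  -- `MS` keeps the gates on groups inside `S`, `MC` the others. The latter commute with `H` and
  -- cancel by unitarity.
  have hsplit : tensorLayer e M = tensorLayer e MC * tensorLayer e MS := by
    rw [tensorLayer_mul]
    congr 1
    ext1 i
    by_cases h : ∀ j, q j = i → j ∈ S
    · simp only [MC, MS, if_pos h, one_mul]
    · simp only [MC, MS, if_neg h, mul_one]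
  have hMC : (tensorLayer e MC)ᴴ * tensorLayer e MC = 1 :=
    tensorLayer_unitary e fun i => by
      by_cases h : ∀ j, q j = i → j ∈ S
      · simp only [MC, if_pos h, Matrix.conjTranspose_one, one_mul]
      · simp only [MC, if_neg h, hM]
  -- Since `S` is a union of groups, a group not contained in `S` does not meet it.
  have hloc : LocalOn Sᶜ (tensorLayer e MC) := localOn_tensorLayer he fun i => by
    by_cases h : ∀ j, q j = i → j ∈ S
    · exact Or.inr (if_pos h)
    · refine Or.inl fun j hj => Finset.mem_compl.2 fun hjS => h fun j' hj' => ?_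
      exact hS j j' (hj.trans hj'.symm) hjS
  have hcomm := hH.commute_compl hloc
  calc (tensorLayer e M)ᴴ * H * tensorLayer e M
      = (tensorLayer e MS)ᴴ * ((tensorLayer e MC)ᴴ * (H * tensorLayer e MC)) *
          tensorLayer e MS := by
        rw [hsplit, Matrix.conjTranspose_mul]; simp only [Matrix.mul_assoc]
    _ = _ := by rw [hcomm, ← Matrix.mul_assoc (tensorLayer e MC)ᴴ, hMC, Matrix.one_mul]

theorem localOn_conj_tensorLayer [DecidableEq ι] {e : (Fin m → Fin 2) ≃ ∀ i, β i} {q : Fin m → ι}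
    (he : ∀ a b i, e a i = e b i ↔ ∀ j, q j = i → a j = b j)
    {S : Finset (Fin m)} (hS : ∀ j j', q j = q j' → j ∈ S → j' ∈ S)
    {M : ∀ i, Matrix (β i) (β i) ℂ} (hM : ∀ i, (M i)ᴴ * M i = 1) {H : QubitOp m}
    (hH : LocalOn S H) : LocalOn S ((tensorLayer e M)ᴴ * H * tensorLayer e M) := by
  classical
  rw [conj_tensorLayer he hS hM hH]
  have h : LocalOn S (tensorLayer e fun i => if ∀ j, q j = i → j ∈ S then M i else 1) :=
    localOn_tensorLayer he fun i => by
      by_cases h : ∀ j, q j = i → j ∈ S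
      · exact Or.inl h
      · exact Or.inr (if_neg h)
  exact (h.conjTranspose.mul hH).mul h

end TensorLayer

/-! ### Single-qubit observables, unitarity and blocks -/

section OnQubit

variable {m : ℕ} (k : Fin m)

theorem onQubit_eq_tensorLayer (A : Matrix (Fin 2) (Fin 2) ℂ) :
    onQubit k A = tensorLayer (Equiv.refl (Fin m → Fin 2)) (Function.update 1 k A) := by
  ext a b
  simp only [onQubit, tensorLayer, piTensor, Matrix.submatrix_apply, Equiv.refl_apply]
  rw [← Finset.mul_prod_erase Finset.univ _ (Finset.mem_univ k), Function.update_self]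
  split_ifs with h
  · rw [Finset.prod_eq_one, mul_one]
    intro j hj
    have hjk := Finset.ne_of_mem_erase hj
    rw [Function.update_of_ne hjk, Pi.one_apply, h j hjk, Matrix.one_apply_eq]
  · push Not at h
    obtain ⟨j, hjk, hj⟩ := h
    rw [Finset.prod_eq_zero (Finset.mem_erase.2 ⟨hjk, Finset.mem_univ j⟩), mul_zero]
    rw [Function.update_of_ne hjk, Pi.one_apply, Matrix.one_apply_ne hj]

theorem localOn_onQubit (A : Matrix (Fin 2) (Fin 2) ℂ) : LocalOn {k} (onQubit k A) := by
  rw [onQubit_eq_tensorLayer]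
  refine localOn_tensorLayer (q := id) (fun a b i => by simp) fun i => ?_
  by_cases h : i = k
  · exact Or.inl fun j hj => by simpa [h] using hj
  · exact Or.inr (Function.update_of_ne h _ _)

theorem onQubit_conjTranspose_mul_self (B : Matrix (Fin 2) (Fin 2) ℂ) :
    onQubit k (Bᴴ * B) = (onQubit k B)ᴴ * onQubit k B := by
  simp only [onQubit_eq_tensorLayer]
  rw [conjTranspose_tensorLayer, tensorLayer_mul]
  congr 1
  ext1 i
  by_cases h : i = k
  · subst h; simp
  · simp [Function.update_of_ne h]

theorem onQubit_one : onQubit k 1 = 1 := by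
  rw [onQubit_eq_tensorLayer, ← tensorLayer_one (Equiv.refl (Fin m → Fin 2))]
  congr 1
  exact Function.update_eq_self k 1

theorem onQubit_add (A B : Matrix (Fin 2) (Fin 2) ℂ) :
    onQubit k (A + B) = onQubit k A + onQubit k B := by
  ext a b
  by_cases h : ∀ j, j ≠ k → a j = b j
  · simp [onQubit, Matrix.add_apply, if_pos h]
  · simp [onQubit, Matrix.add_apply, if_neg h]

theorem onQubit_neg (A : Matrix (Fin 2) (Fin 2) ℂ) : onQubit k (-A) = -onQubit k A := by
  ext a b
  by_cases h : ∀ j, j ≠ k → a j = b j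
  · simp [onQubit, Matrix.neg_apply, if_pos h]
  · simp [onQubit, Matrix.neg_apply, if_neg h]

open scoped MatrixOrder ComplexOrder in
theorem posSemidef_onQubit {A : Matrix (Fin 2) (Fin 2) ℂ} (hA : A.PosSemidef) :
    (onQubit k A).PosSemidef := by
  obtain ⟨B, rfl⟩ := CStarAlgebra.nonneg_iff_eq_star_mul_self.1 hA.nonneg
  rw [Matrix.star_eq_conjTranspose, onQubit_conjTranspose_mul_self]
  exact Matrix.posSemidef_conjTranspose_mul_self _

end OnQubit

open scoped ComplexOrder in
theorem posSemidef_of_spectrum_nonneg {n : Type*} [Fintype n] [DecidableEq n] {A : Matrix n n ℂ}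
    (hA : A.IsHermitian) (h : ∀ r ∈ spectrum ℝ A, 0 ≤ r) : A.PosSemidef :=
  hA.posSemidef_iff_eigenvalues_nonneg.2 fun i => h _ (hA.eigenvalues_mem_spectrum_real i)

theorem conjTranspose_exp_mul_exp {n : Type*} [Fintype n] [DecidableEq n] {A : Matrix n n ℂ}
    (hA : Aᴴ = -A) : (NormedSpace.exp A)ᴴ * NormedSpace.exp A = 1 := by
  rw [← Matrix.exp_conjTranspose, hA, ← Matrix.exp_add_of_commute _ _ (Commute.refl A).neg_left,
    neg_add_cancel, NormedSpace.exp_zero]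

/-- A bit string is the same as the family of its restrictions to the blocks of a partition. -/
noncomputable def blockEquiv {m : ℕ} (π : Finpartition (Finset.univ : Finset (Fin m))) :
    (Fin m → Fin 2) ≃ ∀ E : π.parts, (E.1 → Fin 2) :=
  Equiv.ofBijective (fun a _ j => a j) <| by
    constructor
    · intro a b h
      ext1 j
      have hj : j ∈ π.part j := π.mem_part_self.2 (Finset.mem_univ j)
      exact congrFun (congrFun h ⟨π.part j, π.part_mem.2 (Finset.mem_univ j)⟩) ⟨j, hj⟩
    · intro c
      refine ⟨fun j => c ⟨π.part j, π.part_mem.2 (Finset.mem_univ j)⟩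
        ⟨j, π.mem_part_self.2 (Finset.mem_univ j)⟩, ?_⟩
      ext1 ⟨E, hE⟩
      ext1 ⟨j, hj⟩
      have hpart : π.part j = E := π.part_eq_of_mem hE hj
      subst hpart
      rfl

theorem blockEquiv_apply {m : ℕ} (π : Finpartition (Finset.univ : Finset (Fin m)))
    (a : Fin m → Fin 2) (E : π.parts) (j : E.1) : blockEquiv π a E j = a j := rfl

/-- This is the compatibility `he` required of a tensor layer, with `q` sending a qubit to its
block. -/
theorem blockEquiv_eq_iff {m : ℕ} (π : Finpartition (Finset.univ : Finset (Fin m)))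
    (a b : Fin m → Fin 2) (E : π.parts) : blockEquiv π a E = blockEquiv π b E ↔
      ∀ j, (⟨π.part j, π.part_mem.2 (Finset.mem_univ j)⟩ : π.parts) = E → a j = b j := by
  obtain ⟨E, hE⟩ := E
  simp only [funext_iff, blockEquiv_apply, Subtype.forall, Subtype.mk.injEq,
    π.part_eq_iff_mem hE]

/-! ### Light cones in the Heisenberg picture, and bounds on the local outputs -/

namespace QuantumCircuit

variable {𝒳 : Type*} {m : ℕ} (C : QuantumCircuit 𝒳 m)

theorem conjTranspose_paramGate_mul_self (i : C.Param) (t : ℝ) :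
    (C.paramGate i t)ᴴ * C.paramGate i t = 1 := by
  refine conjTranspose_exp_mul_exp ?_
  rw [Matrix.conjTranspose_smul, (C.gen_isHermitian i.1 i.2).eq, ← neg_smul]
  congr 1
  simp

theorem paramLayer_eq_tensorLayer (ℓ : Fin C.depth) (θ : C.Param → ℝ) :
    C.paramLayer ℓ θ = tensorLayer (Equiv.refl (Fin m → Fin 2))
      fun k => C.paramGate (ℓ, k) (θ (ℓ, k)) := rfl

theorem inputLayer_eq_tensorLayer (ℓ : Fin C.depth) (x : 𝒳) :
    C.inputLayer ℓ x = tensorLayer (blockEquiv (C.blocks ℓ))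
      fun E => (C.gate ℓ E.1 x : Matrix (E.1 → Fin 2) (E.1 → Fin 2) ℂ) := by
  ext a b
  exact (Finset.prod_coe_sort (C.blocks ℓ).parts fun E =>
    (C.gate ℓ E x : Matrix (E → Fin 2) (E → Fin 2) ℂ) (fun j => a j) (fun j => b j)).symm

theorem conjTranspose_gate_mul_self (ℓ : Fin C.depth) (E : Finset (Fin m)) (x : 𝒳) :
    (C.gate ℓ E x : Matrix (E → Fin 2) (E → Fin 2) ℂ)ᴴ * (C.gate ℓ E x).1 = 1 :=
  Matrix.mem_unitaryGroup_iff'.1 (C.gate ℓ E x).2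

/-- The product `U_ℓ ⋯ U_1` of the first layers of the circuit. -/
noncomputable def prefixUnitary (θ : C.Param → ℝ) (x : 𝒳) (ℓ : Fin (C.depth + 1)) : QubitOp m :=
  Fin.induction (motive := fun _ => QubitOp m) 1
    (fun ℓ U => (C.inputLayer ℓ x * C.paramLayer ℓ θ) * U) ℓ

theorem prefixUnitary_zero (θ : C.Param → ℝ) (x : 𝒳) : C.prefixUnitary θ x 0 = 1 := rfl

theorem prefixUnitary_succ (θ : C.Param → ℝ) (x : 𝒳) (ℓ : Fin C.depth) :
    C.prefixUnitary θ x ℓ.succ =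
      (C.inputLayer ℓ x * C.paramLayer ℓ θ) * C.prefixUnitary θ x ℓ.castSucc := by
  simp [prefixUnitary]

theorem prefixUnitary_last (θ : C.Param → ℝ) (x : 𝒳) :
    C.prefixUnitary θ x (Fin.last C.depth) = C.unitary θ x := rfl

theorem conjTranspose_layer_mul_self (θ : C.Param → ℝ) (x : 𝒳) (ℓ : Fin C.depth) :
    (C.inputLayer ℓ x * C.paramLayer ℓ θ)ᴴ * (C.inputLayer ℓ x * C.paramLayer ℓ θ) = 1 := by
  have hV : (C.inputLayer ℓ x)ᴴ * C.inputLayer ℓ x = 1 := by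
    rw [inputLayer_eq_tensorLayer]
    exact tensorLayer_unitary _ fun E => C.conjTranspose_gate_mul_self ℓ E.1 x
  have hW : (C.paramLayer ℓ θ)ᴴ * C.paramLayer ℓ θ = 1 := by
    rw [paramLayer_eq_tensorLayer]
    exact tensorLayer_unitary _ fun k => C.conjTranspose_paramGate_mul_self (ℓ, k) _
  rw [Matrix.conjTranspose_mul, Matrix.mul_assoc, ← Matrix.mul_assoc (C.inputLayer ℓ x)ᴴ, hV,
    Matrix.one_mul, hW]

theorem conjTranspose_prefixUnitary_mul_self (θ : C.Param → ℝ) (x : 𝒳)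
    (ℓ : Fin (C.depth + 1)) :
    (C.prefixUnitary θ x ℓ)ᴴ * C.prefixUnitary θ x ℓ = 1 := by
  induction ℓ using Fin.induction with
  | zero => rw [prefixUnitary_zero, Matrix.conjTranspose_one, Matrix.one_mul]
  | succ ℓ ih =>
    rw [prefixUnitary_succ, Matrix.conjTranspose_mul, Matrix.mul_assoc,
      ← Matrix.mul_assoc (C.inputLayer ℓ x * C.paramLayer ℓ θ)ᴴ, conjTranspose_layer_mul_self,
      Matrix.one_mul, ih]

theorem subset_biUnion_interacting (ℓ : Fin C.depth) (J : Finset (Fin m)) :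
    J ⊆ J.biUnion (C.interacting ℓ) := fun j hj =>
  Finset.mem_biUnion.2 ⟨j, hj, (C.blocks ℓ).mem_part_self.2 (Finset.mem_univ j)⟩

/-- The cone before a layer is a union of blocks of that layer, so no two-qubit gate straddles its
boundary. -/
theorem mem_biUnion_interacting_of_part_eq (ℓ : Fin C.depth) (J : Finset (Fin m))
    {j j' : Fin m} (h : (C.blocks ℓ).part j = (C.blocks ℓ).part j')
    (hj : j ∈ J.biUnion (C.interacting ℓ)) : j' ∈ J.biUnion (C.interacting ℓ) := by
  obtain ⟨i, hi, hji⟩ := Finset.mem_biUnion.1 hj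
  refine Finset.mem_biUnion.2 ⟨i, hi, ?_⟩
  have hji : j ∈ (C.blocks ℓ).part i := hji
  rw [(C.blocks ℓ).mem_part_iff_part_eq_part (Finset.mem_univ _) (Finset.mem_univ _)] at hji
  exact ((C.blocks ℓ).mem_part_iff_part_eq_part (Finset.mem_univ _) (Finset.mem_univ _)).2
    (by rw [← hji, h])

/-- In the Heisenberg picture, the observable on the qubit `k` before the layer `ℓ` is local on the
past cone, and it is the same for parameters that agree on the past light cone. -/
theorem exists_heisenberg (k : Fin m) {θ θ' : C.Param → ℝ}
    (h : ∀ i ∈ C.pastCone k, θ i = θ' i) (x : 𝒳) (A : Matrix (Fin 2) (Fin 2) ℂ)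
    (ℓ : Fin (C.depth + 1)) : ∃ H : QubitOp m, LocalOn (C.cone k ℓ) H ∧
      (C.unitary θ x)ᴴ * onQubit k A * C.unitary θ x =
        (C.prefixUnitary θ x ℓ)ᴴ * H * C.prefixUnitary θ x ℓ ∧
      (C.unitary θ' x)ᴴ * onQubit k A * C.unitary θ' x =
        (C.prefixUnitary θ' x ℓ)ᴴ * H * C.prefixUnitary θ' x ℓ := by
  classical
  induction ℓ using Fin.reverseInduction with
  | last => exact ⟨onQubit k A, by rw [cone_last]; exact localOn_onQubit k A, rfl, rfl⟩
  | cast ℓ ih =>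
    obtain ⟨H, hH, h1, h2⟩ := ih
    set S := C.cone k ℓ.castSucc with hSdef
    -- Undoing the input-dependent gates enlarges the cone after the layer to the union `S` of the
    -- blocks that it meets. The parameterized gates, acting on single qubits, do not enlarge it
    -- further.
    have hV : LocalOn S ((C.inputLayer ℓ x)ᴴ * H * C.inputLayer ℓ x) := by
      rw [inputLayer_eq_tensorLayer]
      refine localOn_conj_tensorLayer
        (q := fun j => ⟨(C.blocks ℓ).part j, (C.blocks ℓ).part_mem.2 (Finset.mem_univ j)⟩)
        (blockEquiv_eq_iff _) ?_ (fun E => C.conjTranspose_gate_mul_self ℓ E.1 x) (hH.mono ?_)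
      · intro j j' hjj' hj
        rw [hSdef, cone_castSucc] at hj ⊢
        exact C.mem_biUnion_interacting_of_part_eq ℓ _ (congrArg Subtype.val hjj') hj
      · rw [hSdef, cone_castSucc]
        exact C.subset_biUnion_interacting ℓ _
    have he : ∀ (a b : Fin m → Fin 2) i, Equiv.refl (Fin m → Fin 2) a i =
        Equiv.refl (Fin m → Fin 2) b i ↔ ∀ j, id j = i → a j = b j := by simp
    have hS : ∀ j j' : Fin m, id j = id j' → j ∈ S → j' ∈ S := by
      rintro j _ rfl hj; exact hj
    have hW : ∀ θ : C.Param → ℝ, ∀ i, (C.paramGate (ℓ, i) (θ (ℓ, i)))ᴴ *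
        C.paramGate (ℓ, i) (θ (ℓ, i)) = 1 := fun θ i => C.conjTranspose_paramGate_mul_self _ _
    -- The parameters of the layer `ℓ` at the qubits of `S` belong to the past light cone, where `θ`
    -- and `θ'` agree.
    have hgates : (fun i => if ∀ j, id j = i → j ∈ S then C.paramGate (ℓ, i) (θ (ℓ, i)) else 1) =
        fun i => if ∀ j, id j = i → j ∈ S then C.paramGate (ℓ, i) (θ' (ℓ, i)) else 1 := by
      ext1 i
      split_ifs with hi
      · rw [h (ℓ, i) (by simpa [pastCone] using hi i rfl)]
      · rfl
    refine ⟨(C.paramLayer ℓ θ)ᴴ * ((C.inputLayer ℓ x)ᴴ * H * C.inputLayer ℓ x) *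
      C.paramLayer ℓ θ, ?_, ?_, ?_⟩
    · rw [paramLayer_eq_tensorLayer]
      exact localOn_conj_tensorLayer he hS (hW θ) hV
    · rw [h1, prefixUnitary_succ]
      simp only [Matrix.conjTranspose_mul, Matrix.mul_assoc]
    -- The witness is built with `θ`. It serves `θ'` as well, because only the gates on `S` matter.
    · have : (C.paramLayer ℓ θ)ᴴ * ((C.inputLayer ℓ x)ᴴ * H * C.inputLayer ℓ x) *
          C.paramLayer ℓ θ = (C.paramLayer ℓ θ')ᴴ *
            ((C.inputLayer ℓ x)ᴴ * H * C.inputLayer ℓ x) * C.paramLayer ℓ θ' := by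
        rw [paramLayer_eq_tensorLayer, paramLayer_eq_tensorLayer,
          conj_tensorLayer he hS (hW θ) hV, conj_tensorLayer he hS (hW θ') hV, hgates]
      rw [this, h2, prefixUnitary_succ]
      simp only [Matrix.conjTranspose_mul, Matrix.mul_assoc]

/-- Before the first layer the prefix is the identity, so both evolved observables equal the same
operator `H`. -/
theorem localOutput_congr (k : Fin m) {θ θ' : C.Param → ℝ}
    (h : ∀ i ∈ C.pastCone k, θ i = θ' i) (x : 𝒳) :
    C.localOutput k θ x = C.localOutput k θ' x := by
  obtain ⟨H, -, h1, h2⟩ := C.exists_heisenberg k h x (C.obs k) 0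
  simp only [prefixUnitary_zero] at h1 h2
  rw [localOutput, localOutput, expval, expval, h1, h2]

open scoped ComplexOrder in
theorem expval_nonneg {A : QubitOp m} (hA : A.PosSemidef) (θ : C.Param → ℝ) (x : 𝒳) :
    0 ≤ C.expval A θ x :=
  (Complex.le_def.1 (hA.conjTranspose_mul_mul_same (C.unitary θ x)).diag_nonneg).1

theorem expval_one (θ : C.Param → ℝ) (x : 𝒳) : C.expval 1 θ x = 1 := by
  rw [expval, Matrix.mul_one, ← prefixUnitary_last, conjTranspose_prefixUnitary_mul_self]
  simp

theorem expval_add (A B : QubitOp m) (θ : C.Param → ℝ) (x : 𝒳) :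
    C.expval (A + B) θ x = C.expval A θ x + C.expval B θ x := by
  simp [expval, Matrix.mul_add, Matrix.add_mul]

theorem expval_neg (A : QubitOp m) (θ : C.Param → ℝ) (x : 𝒳) :
    C.expval (-A) θ x = -C.expval A θ x := by
  simp [expval]

open scoped ComplexOrder in
-- The spectral bound makes 1 ± O_k positive semidefinite. Expectations of positive operators are
-- nonnegative, and that of the identity is 1.
theorem abs_localOutput_le_one (k : Fin m) (θ : C.Param → ℝ) (x : 𝒳) :
    |C.localOutput k θ x| ≤ 1 := by
  have hadd : (1 + C.obs k).PosSemidef := by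
    refine posSemidef_of_spectrum_nonneg (Matrix.isHermitian_one.add (C.obs_isHermitian k)) ?_
    intro r hr
    have : r ∈ spectrum ℝ (algebraMap ℝ (Matrix (Fin 2) (Fin 2) ℂ) 1 + C.obs k) := by
      rwa [map_one]
    rw [← spectrum.singleton_add_eq, Set.singleton_add] at this
    obtain ⟨s, hs, rfl⟩ := this
    linarith [(C.obs_spectrum k hs).1]
  have hsub : (1 + -C.obs k).PosSemidef := by
    refine posSemidef_of_spectrum_nonneg
      (Matrix.isHermitian_one.add (C.obs_isHermitian k).neg) ?_
    intro r hr
    have : r ∈ spectrum ℝ (algebraMap ℝ (Matrix (Fin 2) (Fin 2) ℂ) 1 + -C.obs k) := by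
      rwa [map_one]
    rw [← spectrum.singleton_add_eq, Set.singleton_add] at this
    obtain ⟨s, hs, rfl⟩ := this
    rw [← spectrum.neg_eq, Set.mem_neg] at hs
    linarith [(C.obs_spectrum k hs).2]
  have h1 := C.expval_nonneg (posSemidef_onQubit k hadd) θ x
  have h2 := C.expval_nonneg (posSemidef_onQubit k hsub) θ x
  rw [onQubit_add, onQubit_one, expval_add, expval_one] at h1 h2
  rw [onQubit_neg, expval_neg] at h2
  exact abs_le.2 ⟨by rw [localOutput]; linarith, by rw [localOutput]; linarith⟩

open scoped Matrix.Norms.Operator in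
theorem continuous_paramGate (i : C.Param) : Continuous (C.paramGate i) := by
  unfold paramGate
  exact NormedSpace.exp_continuous.comp (by fun_prop)

theorem continuous_prefixUnitary (x : 𝒳) (ℓ : Fin (C.depth + 1)) :
    Continuous fun θ => C.prefixUnitary θ x ℓ := by
  induction ℓ using Fin.induction with
  | zero => exact continuous_const
  | succ ℓ ih =>
    simp only [prefixUnitary_succ]
    refine (continuous_const.matrix_mul ?_).matrix_mul ih
    refine continuous_matrix fun a b => continuous_finsetProd _ fun k _ => ?_
    exact ((C.continuous_paramGate (ℓ, k)).comp (continuous_apply _)).matrix_elem _ _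

theorem continuous_localOutput (k : Fin m) (x : 𝒳) :
    Continuous fun θ => C.localOutput k θ x := by
  have hU : Continuous fun θ => C.unitary θ x := C.continuous_prefixUnitary x (Fin.last _)
  exact Complex.continuous_re.comp
    (((hU.matrix_conjTranspose.matrix_mul continuous_const).matrix_mul hU).matrix_elem _ _)

end QuantumCircuit

/-! ### Central limit theorem for local dependence -/

theorem norm_exp_I_mul_sub_le (x y : ℝ) :
    ‖Complex.exp (Complex.I * x) - Complex.exp (Complex.I * y)‖ ≤ |x - y| := by
  have h : Complex.exp (Complex.I * x) - Complex.exp (Complex.I * y) =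
      Complex.exp (Complex.I * y) * (Complex.exp (Complex.I * (x - y : ℝ)) - 1) := by
    rw [mul_sub, ← Complex.exp_add, mul_one]
    congr 2
    push_cast; ring
  rw [h, norm_mul, Complex.norm_exp_I_mul_ofReal, one_mul]
  exact Real.norm_exp_I_mul_ofReal_sub_one_le

theorem norm_exp_I_mul_sub_one_sub_le (x : ℝ) :
    ‖Complex.exp (Complex.I * x) - 1 - Complex.I * x‖ ≤ 3 * x ^ 2 := by
  have hx : ‖Complex.I * (x : ℂ)‖ = |x| := by simp
  rcases le_total |x| 1 with h | h
  · refine (Complex.norm_exp_sub_one_sub_id_le (hx.trans_le h)).trans ?_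
    rw [hx, sq_abs]
    nlinarith [sq_nonneg x]
  · calc ‖Complex.exp (Complex.I * x) - 1 - Complex.I * x‖
        ≤ ‖Complex.exp (Complex.I * x) - 1‖ + ‖Complex.I * (x : ℂ)‖ := norm_sub_le _ _
      _ ≤ |x| + |x| := add_le_add Real.norm_exp_I_mul_ofReal_sub_one_le hx.le
      _ ≤ 3 * x ^ 2 := by nlinarith [sq_abs x]

section LocalDependence

variable {Ω : Type*} [MeasurableSpace Ω] {P : Measure Ω} [IsProbabilityMeasure P]

theorem integrable_mul_exp {Z W : Ω → ℝ} (hZ : Measurable Z) (hW : Measurable W) {b : ℝ}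
    (hb : ∀ ω, |Z ω| ≤ b) (t : ℝ) :
    Integrable (fun ω => (Z ω : ℂ) * Complex.exp (Complex.I * (t * W ω : ℝ))) P := by
  refine Integrable.of_bound (by fun_prop) b (ae_of_all _ fun ω => ?_)
  rw [norm_mul, Complex.norm_exp_I_mul_ofReal, mul_one, Complex.norm_real]
  exact hb ω

theorem integrable_exp {W : Ω → ℝ} (hW : Measurable W) (t : ℝ) :
    Integrable (fun ω => Complex.exp (Complex.I * (t * W ω : ℝ))) P := by
  simpa using integrable_mul_exp (P := P) (Z := fun _ => 1) measurable_const hW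
    (b := 1) (by simp) t

omit [IsProbabilityMeasure P] in
theorem integral_mul_exp_of_indepFun {Z W : Ω → ℝ} (hZ : Measurable Z) (hW : Measurable W)
    (h : IndepFun Z W P) (t : ℝ) :
    ∫ ω, (Z ω : ℂ) * Complex.exp (Complex.I * (t * W ω : ℝ)) ∂P =
      ((∫ ω, Z ω ∂P : ℝ) : ℂ) * ∫ ω, Complex.exp (Complex.I * (t * W ω : ℝ)) ∂P := by
  have h' := h.comp (φ := fun z : ℝ => (z : ℂ))
    (ψ := fun w : ℝ => Complex.exp (Complex.I * (t * w : ℝ))) (by fun_prop) (by fun_prop)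
  have := h'.integral_fun_mul_eq_mul_integral (by fun_prop) (by fun_prop)
  simp only [Function.comp_apply] at this
  rw [this, ← integral_complex_ofReal]

/-- If `Z` is bounded by `b` and independent of a variable at a distance at most `c` from `W`,
then the covariance of `Z` and `exp (i t W)` is small. -/
theorem norm_integral_mul_exp_sub_le {Z W W' : Ω → ℝ} (hZ : Measurable Z) (hW : Measurable W)
    (hW' : Measurable W') (h : IndepFun Z W' P) {b c : ℝ} (hb : ∀ ω, |Z ω| ≤ b)
    (hc : ∀ ω, |W ω - W' ω| ≤ c) (t : ℝ) :
    ‖∫ ω, (Z ω : ℂ) * Complex.exp (Complex.I * (t * W ω : ℝ)) ∂P -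
      ((∫ ω, Z ω ∂P : ℝ) : ℂ) * ∫ ω, Complex.exp (Complex.I * (t * W ω : ℝ)) ∂P‖ ≤
        2 * (b * (|t| * c)) := by
  have hexp : ∀ ω, ‖Complex.exp (Complex.I * (t * W ω : ℝ)) -
      Complex.exp (Complex.I * (t * W' ω : ℝ))‖ ≤ |t| * c := fun ω => by
    refine (norm_exp_I_mul_sub_le _ _).trans ?_
    rw [← mul_sub, abs_mul]
    exact mul_le_mul_of_nonneg_left (hc ω) (abs_nonneg t)
  have hb0 : 0 ≤ b := by
    obtain ⟨ω⟩ := nonempty_of_isProbabilityMeasure P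
    exact (abs_nonneg _).trans (hb ω)
  have h1 : ‖∫ ω, (Z ω : ℂ) * Complex.exp (Complex.I * (t * W ω : ℝ)) ∂P -
      ∫ ω, (Z ω : ℂ) * Complex.exp (Complex.I * (t * W' ω : ℝ)) ∂P‖ ≤ b * (|t| * c) := by
    rw [← integral_sub (integrable_mul_exp hZ hW hb t) (integrable_mul_exp hZ hW' hb t)]
    refine (norm_integral_le_of_norm_le_const (C := b * (|t| * c)) (ae_of_all _ fun ω => ?_)).trans
      (by simp)
    rw [← mul_sub, norm_mul, Complex.norm_real]
    exact mul_le_mul (hb ω) (hexp ω) (norm_nonneg _) hb0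
  have h2 : ‖((∫ ω, Z ω ∂P : ℝ) : ℂ)‖ ≤ b := by
    rw [Complex.norm_real]
    exact (norm_integral_le_of_norm_le_const (ae_of_all _ hb)).trans (by simp)
  have h3 : ‖∫ ω, Complex.exp (Complex.I * (t * W ω : ℝ)) ∂P -
      ∫ ω, Complex.exp (Complex.I * (t * W' ω : ℝ)) ∂P‖ ≤ |t| * c := by
    rw [← integral_sub (integrable_exp hW t) (integrable_exp hW' t)]
    exact (norm_integral_le_of_norm_le_const (ae_of_all _ hexp)).trans (by simp)
  rw [integral_mul_exp_of_indepFun hZ hW' h] at h1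
  set p := ((∫ ω, Z ω ∂P : ℝ) : ℂ)
  set φ := ∫ ω, Complex.exp (Complex.I * (t * W ω : ℝ)) ∂P
  set φ' := ∫ ω, Complex.exp (Complex.I * (t * W' ω : ℝ)) ∂P
  -- `W` is replaced by `W'` twice, once next to `Z` and once in the characteristic function; each
  -- replacement costs `b * (|t| * c)`.
  calc ‖∫ ω, (Z ω : ℂ) * Complex.exp (Complex.I * (t * W ω : ℝ)) ∂P - p * φ‖
      = ‖(∫ ω, (Z ω : ℂ) * Complex.exp (Complex.I * (t * W ω : ℝ)) ∂P - p * φ') -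
          p * (φ - φ')‖ := by ring_nf
    _ ≤ b * (|t| * c) + b * (|t| * c) := by
        refine (norm_sub_le _ _).trans (add_le_add h1 ?_)
        rw [norm_mul]
        exact mul_le_mul h2 h3 (norm_nonneg _) hb0
    _ = _ := by ring

variable {κ : Type*} {X : κ → Ω → ℝ} {A : κ → Finset κ} {B : ℝ} {D : ℕ}

omit [MeasurableSpace Ω] in
theorem abs_sum_le_card_mul (hB : ∀ k ω, |X k ω| ≤ B) (s : Finset κ) (ω : Ω) :
    |∑ j ∈ s, X j ω| ≤ s.card * B := by
  refine (Finset.abs_sum_le_sum_abs _ _).trans ((Finset.sum_le_sum fun j _ => hB j ω).trans ?_)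
  simp

variable [Fintype κ] [DecidableEq κ]

/-- Write W = Y + W', with Y the sum over the neighbours of `k`. The variable X_k is centred and
independent of W', so only the first-order term it E[X_k Y exp(itW)] and a quadratic remainder
survive. Each product X_k X_j is independent of the sum over the complement of `A k ∪ A j`, hence
almost uncorrelated with exp(itW). Summed over `k`, this yields φ' ≈ -t v φ. -/
theorem norm_integral_mul_exp_sum_sub_le (hX : ∀ k, Measurable (X k))
    (hB0 : 0 ≤ B) (hB : ∀ k ω, |X k ω| ≤ B) (hmean : ∀ k, ∫ ω, X k ω ∂P = 0)
    (hcard : ∀ k, (A k).card ≤ D)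
    (hindep : ∀ k j, IndepFun (fun ω => (X k ω, X j ω))
      (fun ω => ∑ l ∈ (A k ∪ A j)ᶜ, X l ω) P) (t : ℝ) (k : κ) :
    ‖∫ ω, (X k ω : ℂ) * Complex.exp (Complex.I * (t * ∑ l, X l ω : ℝ)) ∂P -
      Complex.I * t * ((∑ j ∈ A k, ∫ ω, X k ω * X j ω ∂P : ℝ) : ℂ) *
        ∫ ω, Complex.exp (Complex.I * (t * ∑ l, X l ω : ℝ)) ∂P‖ ≤ 7 * t ^ 2 * D ^ 2 * B ^ 3 := by
  set W : Ω → ℝ := fun ω => ∑ l, X l ω with hWdef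
  have hW : Measurable W := Finset.measurable_sum _ fun l _ => hX l
  set W' : Ω → ℝ := fun ω => ∑ l ∈ (A k)ᶜ, X l ω with hWdef'
  have hW' : Measurable W' := Finset.measurable_sum _ fun l _ => hX l
  set Y : Ω → ℝ := fun ω => ∑ l ∈ A k, X l ω with hYdef
  have hY : Measurable Y := Finset.measurable_sum _ fun l _ => hX l
  have hYB : ∀ ω, |Y ω| ≤ D * B := fun ω =>
    (abs_sum_le_card_mul hB _ ω).trans
      (mul_le_mul_of_nonneg_right (by exact_mod_cast hcard k) hB0)
  have hsum : ∀ ω, W ω = Y ω + W' ω := fun ω => (Finset.sum_add_sum_compl _ _).symm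
  have hpair : ∀ j, ∀ ω, |X k ω * X j ω| ≤ B * B := fun j ω => by
    rw [abs_mul]
    exact mul_le_mul (hB k ω) (hB j ω) (abs_nonneg _) hB0
  have hpair_meas : ∀ j, Measurable fun ω => X k ω * X j ω := fun j => (hX k).mul (hX j)
  -- the term without the neighbours vanishes
  have hzero : ∫ ω, (X k ω : ℂ) * Complex.exp (Complex.I * (t * W' ω : ℝ)) ∂P = 0 := by
    have hi : IndepFun (X k) W' P := by
      have := hindep k k
      rw [Finset.union_self] at this
      exact this.comp (φ := Prod.fst) (ψ := id) measurable_fst measurable_id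
    rw [integral_mul_exp_of_indepFun (hX k) hW' hi, hmean]
    simp
  -- the first-order term
  have hfirst : ‖∫ ω, ((X k ω * Y ω : ℝ) : ℂ) * Complex.exp (Complex.I * (t * W ω : ℝ)) ∂P -
      ((∑ j ∈ A k, ∫ ω, X k ω * X j ω ∂P : ℝ) : ℂ) *
        ∫ ω, Complex.exp (Complex.I * (t * W ω : ℝ)) ∂P‖ ≤
          D * (2 * (B * B * (|t| * (2 * D * B)))) := by
    have h1 : ∫ ω, ((X k ω * Y ω : ℝ) : ℂ) * Complex.exp (Complex.I * (t * W ω : ℝ)) ∂P =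
        ∑ j ∈ A k, ∫ ω, ((X k ω * X j ω : ℝ) : ℂ) *
          Complex.exp (Complex.I * (t * W ω : ℝ)) ∂P := by
      rw [← integral_finsetSum]
      · refine integral_congr_ae (ae_of_all _ fun ω => ?_)
        simp only [hYdef]
        rw [Finset.mul_sum, Complex.ofReal_sum, Finset.sum_mul]
      · exact fun j _ => integrable_mul_exp (hpair_meas j) hW (hpair j) t
    rw [h1, Complex.ofReal_sum, Finset.sum_mul, ← Finset.sum_sub_distrib]
    refine (norm_sum_le_of_le _ fun j _ => norm_integral_mul_exp_sub_le (hpair_meas j) hW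
      (Finset.measurable_sum (A k ∪ A j)ᶜ fun l _ => hX l) ?_ (hpair j) (c := 2 * D * B)
      (fun ω => ?_) t).trans ?_
    · exact (hindep k j).comp (φ := fun p : ℝ × ℝ => p.1 * p.2) (ψ := id) (by fun_prop)
        measurable_id
    · have : W ω - ∑ l ∈ (A k ∪ A j)ᶜ, X l ω = ∑ l ∈ A k ∪ A j, X l ω := by
        simp only [hWdef]
        rw [← Finset.sum_add_sum_compl (A k ∪ A j)]
        ring
      rw [this]
      refine (abs_sum_le_card_mul hB _ ω).trans (mul_le_mul_of_nonneg_right ?_ hB0)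
      have := (Finset.card_union_le (A k) (A j)).trans (add_le_add (hcard k) (hcard j))
      rw [two_mul]
      exact_mod_cast this
    · rw [Finset.sum_const, nsmul_eq_mul]
      refine mul_le_mul_of_nonneg_right (by exact_mod_cast hcard k) ?_
      positivity
  -- the second-order remainder
  have hrem : ‖∫ ω, ((X k ω : ℂ) * Complex.exp (Complex.I * (t * W ω : ℝ)) -
      (X k ω : ℂ) * Complex.exp (Complex.I * (t * W' ω : ℝ)) -
        Complex.I * t * (((X k ω * Y ω : ℝ) : ℂ) *
          Complex.exp (Complex.I * (t * W ω : ℝ)))) ∂P‖ ≤ B * (3 * (t ^ 2 * (D * B) ^ 2)) := by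
    refine (norm_integral_le_of_norm_le_const (C := B * (3 * (t ^ 2 * (D * B) ^ 2)))
      (ae_of_all _ fun ω => ?_)).trans (by simp)
    -- The expansion is made around W rather than W', so that the first-order term carries exp(itW)
    -- and can be compared with φ.
    have hexp : Complex.exp (Complex.I * (t * W' ω : ℝ)) =
        Complex.exp (Complex.I * (t * W ω : ℝ)) *
          Complex.exp (Complex.I * (-(t * Y ω) : ℝ)) := by
      rw [← Complex.exp_add, hsum]
      congr 1
      push_cast; ring
    have : (X k ω : ℂ) * Complex.exp (Complex.I * (t * W ω : ℝ)) -
        (X k ω : ℂ) * Complex.exp (Complex.I * (t * W' ω : ℝ)) -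
        Complex.I * t * (((X k ω * Y ω : ℝ) : ℂ) * Complex.exp (Complex.I * (t * W ω : ℝ))) =
        -(X k ω * (Complex.exp (Complex.I * (t * W ω : ℝ)) *
          (Complex.exp (Complex.I * (-(t * Y ω) : ℝ)) - 1 - Complex.I * (-(t * Y ω) : ℝ)))) := by
      rw [hexp]
      push_cast; ring
    rw [this, norm_neg, norm_mul, norm_mul, Complex.norm_exp_I_mul_ofReal, one_mul,
      Complex.norm_real]
    refine mul_le_mul (hB k ω) ((norm_exp_I_mul_sub_one_sub_le _).trans ?_) (norm_nonneg _) hB0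
    rw [neg_sq, mul_pow]
    have := pow_le_pow_left₀ (abs_nonneg _) (hYB ω) 2
    rw [sq_abs] at this
    gcongr
  have hXY : ∀ ω, |X k ω * Y ω| ≤ B * (D * B) := fun ω => by
    rw [abs_mul]
    exact mul_le_mul (hB k ω) (hYB ω) (abs_nonneg _) hB0
  have hi1 := integrable_mul_exp (P := P) (hX k) hW (hB k) t
  have hi2 := integrable_mul_exp (P := P) (hX k) hW' (hB k) t
  have hi3 := integrable_mul_exp (P := P) (Z := fun ω => X k ω * Y ω) ((hX k).mul hY) hW hXY t
  have hi12 : Integrable (fun ω => (X k ω : ℂ) * Complex.exp (Complex.I * (t * W ω : ℝ)) -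
      (X k ω : ℂ) * Complex.exp (Complex.I * (t * W' ω : ℝ))) P := hi1.sub hi2
  rw [integral_sub hi12 (hi3.const_mul _), integral_sub hi1 hi2, hzero, sub_zero,
    integral_const_mul] at hrem
  set J := ∫ ω, ((X k ω * Y ω : ℝ) : ℂ) * Complex.exp (Complex.I * (t * W ω : ℝ)) ∂P
  set σ := ((∑ j ∈ A k, ∫ ω, X k ω * X j ω ∂P : ℝ) : ℂ)
  set φ := ∫ ω, Complex.exp (Complex.I * (t * W ω : ℝ)) ∂P
  set K := ∫ ω, (X k ω : ℂ) * Complex.exp (Complex.I * (t * W ω : ℝ)) ∂P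
  calc ‖K - Complex.I * t * σ * φ‖
      = ‖(K - Complex.I * t * J) + Complex.I * t * (J - σ * φ)‖ := by ring_nf
    _ ≤ B * (3 * (t ^ 2 * (D * B) ^ 2)) + |t| * (D * (2 * (B * B * (|t| * (2 * D * B))))) := by
        refine (norm_add_le _ _).trans (add_le_add hrem ?_)
        rw [norm_mul]
        refine mul_le_mul (by simp) hfirst (norm_nonneg _) (abs_nonneg t)
    -- 7 = 3 + 4: the quadratic remainder contributes 3, and decoupling the pairs contributes 2 · 2.
    _ = 7 * t ^ 2 * D ^ 2 * B ^ 3 := by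
        rw [← sq_abs t]; ring

theorem hasDerivAt_integral_exp {W : Ω → ℝ} (hW : Measurable W) {b : ℝ} (hb : ∀ ω, |W ω| ≤ b)
    (t : ℝ) :
    HasDerivAt (fun t : ℝ => ∫ ω, Complex.exp (Complex.I * (t * W ω : ℝ)) ∂P)
      (Complex.I * ∫ ω, (W ω : ℂ) * Complex.exp (Complex.I * (t * W ω : ℝ)) ∂P) t := by
  rw [← integral_const_mul]
  refine (hasDerivAt_integral_of_dominated_loc_of_deriv_le (bound := fun _ => b)
    (F := fun (t : ℝ) ω => Complex.exp (Complex.I * (t * W ω : ℝ)))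
    (F' := fun (t : ℝ) ω => Complex.I * ((W ω : ℂ) * Complex.exp (Complex.I * (t * W ω : ℝ))))
    univ_mem (Eventually.of_forall fun s => by fun_prop) (integrable_exp hW t) (by fun_prop)
    (ae_of_all _ fun ω s _ => ?_) (integrable_const b) (ae_of_all _ fun ω s _ => ?_)).2
  · rw [norm_mul, norm_mul, Complex.norm_exp_I_mul_ofReal, Complex.norm_I, one_mul, mul_one,
      Complex.norm_real]
    exact hb ω
  · have h : HasDerivAt (fun s : ℝ => Complex.I * (s * W ω : ℝ)) (Complex.I * (W ω : ℝ)) s := by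
      have := ((hasDerivAt_mul_const (W ω) (x := s)).ofReal_comp).const_mul Complex.I
      simpa using this
    exact h.cexp.congr_deriv (by ring)

/-- **Quantitative central limit theorem for local dependence**, for characteristic functions:
the sum of centred variables `X k` bounded by `B`, each of which depends on at most `D` others, is
approximately Gaussian. -/
theorem norm_charFun_sum_sub_le (hX : ∀ k, Measurable (X k))
    (hB0 : 0 ≤ B) (hB : ∀ k ω, |X k ω| ≤ B) (hmean : ∀ k, ∫ ω, X k ω ∂P = 0)
    (hcard : ∀ k, (A k).card ≤ D) (hindep₁ : ∀ k, ∀ j ∉ A k, IndepFun (X k) (X j) P)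
    (hindep₂ : ∀ k j, IndepFun (fun ω => (X k ω, X j ω))
      (fun ω => ∑ l ∈ (A k ∪ A j)ᶜ, X l ω) P) :
    ‖∫ ω, Complex.exp (Complex.I * (∑ k, X k ω : ℝ)) ∂P -
      Complex.exp (-((∫ ω, (∑ k, X k ω) ^ 2 ∂P : ℝ) : ℂ) / 2)‖ ≤
        7 * Fintype.card κ * D ^ 2 * B ^ 3 := by
  set W : Ω → ℝ := fun ω => ∑ l, X l ω with hWdef
  have hW : Measurable W := Finset.measurable_sum _ fun l _ => hX l
  set φ : ℝ → ℂ := fun t => ∫ ω, Complex.exp (Complex.I * (t * W ω : ℝ)) ∂P with hφ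
  set v : ℝ := ∫ ω, W ω ^ 2 ∂P with hv
  have hv0 : 0 ≤ v := integral_nonneg fun ω => sq_nonneg _
  -- Pairs outside the neighbourhoods are independent and centred, so only neighbouring pairs
  -- contribute to the variance.
  have hvar : v = ∑ k, ∑ j ∈ A k, ∫ ω, X k ω * X j ω ∂P := by
    have hint : ∀ k j, Integrable (fun ω => X k ω * X j ω) P := fun k j =>
      Integrable.of_bound ((hX k).mul (hX j)).aestronglyMeasurable (B * B) (ae_of_all _ fun ω => by
        rw [norm_mul]
        exact mul_le_mul (hB k ω) (hB j ω) (norm_nonneg _) hB0)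
    have : v = ∑ k, ∑ j, ∫ ω, X k ω * X j ω ∂P := by
      rw [hv, ← Finset.sum_congr rfl fun k _ => integral_finsetSum _ fun j _ => hint k j,
        ← integral_finsetSum _ fun k _ => integrable_finsetSum _ fun j _ => hint k j]
      refine integral_congr_ae (ae_of_all _ fun ω => ?_)
      simp only [hWdef]
      rw [sq, Finset.sum_mul_sum]
    rw [this]
    refine Finset.sum_congr rfl fun k _ => (Finset.sum_subset (Finset.subset_univ _) ?_).symm
    intro j _ hj
    rw [(hindep₁ k j hj).integral_fun_mul_eq_mul_integral (hX k).aestronglyMeasurable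
      (hX j).aestronglyMeasurable, hmean, zero_mul]
  set ε : ℝ := 7 * Fintype.card κ * D ^ 2 * B ^ 3 with hε
  have hε0 : 0 ≤ ε := by positivity
  have hderiv : ∀ t, HasDerivAt φ
      (Complex.I * ∫ ω, (W ω : ℂ) * Complex.exp (Complex.I * (t * W ω : ℝ)) ∂P) t := fun t =>
    hasDerivAt_integral_exp hW (abs_sum_le_card_mul hB Finset.univ) t
  -- The approximate Gaussian equation φ' = -t v φ + O(ε). The interval [0, 1] suffices because the
  -- frequency is already absorbed into the variables.
  have hode : ∀ t ∈ Set.Ico (0 : ℝ) 1,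
      ‖(Complex.I * ∫ ω, (W ω : ℂ) * Complex.exp (Complex.I * (t * W ω : ℝ)) ∂P) +
        t * v * φ t‖ ≤ ε := by
    intro t ht
    have h1 : ∫ ω, (W ω : ℂ) * Complex.exp (Complex.I * (t * W ω : ℝ)) ∂P =
        ∑ k, ∫ ω, (X k ω : ℂ) * Complex.exp (Complex.I * (t * W ω : ℝ)) ∂P := by
      rw [← integral_finsetSum _ fun k _ => integrable_mul_exp (hX k) hW (hB k) t]
      refine integral_congr_ae (ae_of_all _ fun ω => ?_)
      simp only [hWdef]
      rw [← Finset.sum_mul, Complex.ofReal_sum]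
    have h2 : (Complex.I * ∫ ω, (W ω : ℂ) * Complex.exp (Complex.I * (t * W ω : ℝ)) ∂P) +
        t * v * φ t = Complex.I * ∑ k,
          (∫ ω, (X k ω : ℂ) * Complex.exp (Complex.I * (t * W ω : ℝ)) ∂P -
            Complex.I * t * ((∑ j ∈ A k, ∫ ω, X k ω * X j ω ∂P : ℝ) : ℂ) * φ t) := by
      rw [Finset.sum_sub_distrib, ← Finset.sum_mul, ← Finset.mul_sum, ← Complex.ofReal_sum,
        ← hvar, h1]
      linear_combination (t * v * φ t : ℂ) * Complex.I_sq
    rw [h2, norm_mul, Complex.norm_I, one_mul]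
    refine (norm_sum_le_of_le _ fun k _ => norm_integral_mul_exp_sum_sub_le hX hB0 hB hmean hcard
      hindep₂ t k).trans ?_
    rw [Finset.sum_const, nsmul_eq_mul, Finset.card_univ, hε]
    have ht2 : t ^ 2 ≤ 1 := pow_le_one₀ ht.1 ht.2.le
    have : 0 ≤ 7 * (Fintype.card κ : ℝ) * D ^ 2 * B ^ 3 := hε0
    nlinarith
  have hgauss : ∀ t : ℝ, HasDerivAt (fun t : ℝ => Complex.exp ((t ^ 2 * v / 2 : ℝ) : ℂ))
      (Complex.exp ((t ^ 2 * v / 2 : ℝ) : ℂ) * (t * v : ℝ)) t := by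
    intro t
    have h : HasDerivAt (fun t : ℝ => t ^ 2 * v / 2) (t * v) t := by
      exact (((hasDerivAt_pow 2 t).mul_const v).div_const 2).congr_deriv (by push_cast; ring)
    exact h.ofReal_comp.cexp
  -- With the integrating factor exp(t²v/2) the main terms of the derivative cancel, leaving at most
  -- exp(v/2) ε. The factor exp(v/2) is divided out at the end, so the bound does not depend on v.
  have hmain := norm_image_sub_le_of_norm_deriv_le_segment_01'
    (f := fun t => Complex.exp ((t ^ 2 * v / 2 : ℝ) : ℂ) * φ t) (C := Real.exp (v / 2) * ε)
    (fun t _ => ((hgauss t).mul (hderiv t)).hasDerivWithinAt) (fun t ht => by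
      have : Complex.exp ((t ^ 2 * v / 2 : ℝ) : ℂ) * (t * v : ℝ) * φ t +
          Complex.exp ((t ^ 2 * v / 2 : ℝ) : ℂ) * (Complex.I *
            ∫ ω, (W ω : ℂ) * Complex.exp (Complex.I * (t * W ω : ℝ)) ∂P) =
          Complex.exp ((t ^ 2 * v / 2 : ℝ) : ℂ) * ((Complex.I *
            ∫ ω, (W ω : ℂ) * Complex.exp (Complex.I * (t * W ω : ℝ)) ∂P) + t * v * φ t) := by
        push_cast; ring
      rw [this, norm_mul, Complex.norm_exp_ofReal]
      refine mul_le_mul (Real.exp_le_exp.2 ?_) (hode t ht) (norm_nonneg _) (Real.exp_pos _).le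
      have : t ^ 2 ≤ 1 := pow_le_one₀ ht.1 ht.2.le
      nlinarith)
  have hφ0 : φ 0 = 1 := by simp [hφ]
  have hφ1 : φ 1 = ∫ ω, Complex.exp (Complex.I * (W ω : ℝ)) ∂P := by simp [hφ]
  simp only [hφ0, one_pow, one_mul, mul_one, ne_eq, OfNat.ofNat_ne_zero, not_false_eq_true,
    zero_pow, zero_mul, zero_div, Complex.ofReal_zero, Complex.exp_zero] at hmain
  have hfac : Complex.exp ((v / 2 : ℝ) : ℂ) * φ 1 - 1 =
      Complex.exp ((v / 2 : ℝ) : ℂ) * (φ 1 - Complex.exp (-(v : ℂ) / 2)) := by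
    rw [mul_sub, ← Complex.exp_add]
    have : ((v / 2 : ℝ) : ℂ) + -(v : ℂ) / 2 = 0 := by push_cast; ring
    rw [this, Complex.exp_zero]
  rw [hfac, norm_mul, Complex.norm_exp_ofReal, hφ1] at hmain
  exact le_of_mul_le_mul_left hmain (Real.exp_pos _)

end LocalDependence

/-! ### Convergence to the Gaussian process -/

section GaussianLimit

variable {T : Type} [Fintype T]

/-- A positive semidefinite kernel on a finite set is the covariance function of the coordinates
under a centred multivariate Gaussian distribution. -/
theorem isGaussianProcessWith_eval [DecidableEq T] {K : T → T → ℝ}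
    (hK : (Matrix.of K).PosSemidef) :
    IsGaussianProcessWith (fun _ => 0) K (fun x (ω : EuclideanSpace ℝ T) => ω x)
      (multivariateGaussian 0 (Matrix.of K)) where
  isGaussianProcess := ⟨fun I =>
    (IsGaussian.hasGaussianLaw_id (μ := multivariateGaussian 0 (Matrix.of K))).map
      (ContinuousLinearMap.pi fun i : I => EuclideanSpace.proj (𝕜 := ℝ) i.1)⟩
  mean_eq t := by
    have h := (EuclideanSpace.proj t : EuclideanSpace ℝ T →L[ℝ] ℝ).integral_comp_id_comm
      (IsGaussian.integrable_id (μ := multivariateGaussian 0 (Matrix.of K)))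
    rw [integral_id_multivariateGaussian, map_zero] at h
    exact h
  covariance_eq s t := covariance_eval_multivariateGaussian hK s t

variable {Ω : ℕ → Type*} [∀ m, MeasurableSpace (Ω m)] {P : ∀ m, Measure (Ω m)}
  {f : ∀ m, T → Ω m → ℝ} {K : T → T → ℝ}

theorem integral_sum_mul_sq {Ω : Type*} [MeasurableSpace Ω] {P : Measure Ω} {f : T → Ω → ℝ}
    (hint : ∀ x y, Integrable (fun ω => f x ω * f y ω) P) (u : T → ℝ) :
    ∫ ω, (∑ x, u x * f x ω) ^ 2 ∂P = ∑ x, ∑ y, u x * (∫ ω, f x ω * f y ω ∂P) * u y := by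
  have hint' : ∀ x y, Integrable (fun ω => u x * (f x ω * f y ω) * u y) P := fun x y =>
    ((hint x y).const_mul _).mul_const _
  have h : ∀ ω, (∑ x, u x * f x ω) ^ 2 = ∑ x, ∑ y, u x * (f x ω * f y ω) * u y := fun ω => by
    rw [sq, Finset.sum_mul_sum]
    exact Finset.sum_congr rfl fun x _ => Finset.sum_congr rfl fun y _ => by ring
  simp_rw [h]
  rw [integral_finsetSum _ fun x _ => integrable_finsetSum _ fun y _ => hint' x y]
  refine Finset.sum_congr rfl fun x _ => ?_
  rw [integral_finsetSum _ fun y _ => hint' x y]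
  exact Finset.sum_congr rfl fun y _ => by rw [integral_mul_const, integral_const_mul]

theorem dotProduct_of_mulVec (u : T → ℝ) :
    u ⬝ᵥ (Matrix.of K) *ᵥ u = ∑ x, ∑ y, u x * K x y * u y := by
  simp [dotProduct, Matrix.mulVec, Finset.mul_sum, mul_assoc]

theorem tendsto_integral_sum_mul_sq
    (hint : ∀ m x y, Integrable (fun ω => f m x ω * f m y ω) (P m))
    (hcov : ∀ x y, Tendsto (fun m => ∫ ω, f m x ω * f m y ω ∂P m) atTop (𝓝 (K x y)))
    (u : T → ℝ) :
    Tendsto (fun m => ∫ ω, (∑ x, u x * f m x ω) ^ 2 ∂P m) atTop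
      (𝓝 (u ⬝ᵥ (Matrix.of K) *ᵥ u)) := by
  simp_rw [integral_sum_mul_sq (hint _), dotProduct_of_mulVec]
  exact tendsto_finsetSum _ fun x _ => tendsto_finsetSum _ fun y _ =>
    ((hcov x y).const_mul _).mul_const _

/-- The quadratic form of `K` is a limit of second moments of linear combinations, hence
nonnegative. Positivity of the kernel thus need not be assumed. -/
theorem posSemidef_of_tendsto_covariance
    (hint : ∀ m x y, Integrable (fun ω => f m x ω * f m y ω) (P m))
    (hcov : ∀ x y, Tendsto (fun m => ∫ ω, f m x ω * f m y ω ∂P m) atTop (𝓝 (K x y))) :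
    (Matrix.of K).PosSemidef := by
  refine .of_dotProduct_mulVec_nonneg (Matrix.IsHermitian.ext fun x y => ?_) fun u => ?_
  · refine tendsto_nhds_unique (hcov y x) ?_
    simpa only [mul_comm, Matrix.of_apply] using hcov x y
  · exact ge_of_tendsto (tendsto_integral_sum_mul_sq hint hcov u)
      (Eventually.of_forall fun m => integral_nonneg fun ω => sq_nonneg _)

/-- A sequence of random functions on a finite set whose characteristic functions are asymptotic to
the Gaussian ones with the same second moments, and whose second moments converge, converges in
distribution to a centred Gaussian process. -/
theorem exists_gaussianProcess_tendstoInDistribution [∀ m, IsProbabilityMeasure (P m)]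
    (hf : ∀ m x, Measurable (f m x))
    (hint : ∀ m x y, Integrable (fun ω => f m x ω * f m y ω) (P m))
    (hcov : ∀ x y, Tendsto (fun m => ∫ ω, f m x ω * f m y ω ∂P m) atTop (𝓝 (K x y)))
    (hchar : ∀ u : T → ℝ, Tendsto (fun m =>
      ∫ ω, Complex.exp (Complex.I * (∑ x, u x * f m x ω : ℝ)) ∂P m -
        Complex.exp (-((∫ ω, (∑ x, u x * f m x ω) ^ 2 ∂P m : ℝ) : ℂ) / 2)) atTop (𝓝 0)) :
    ∃ (Ω' : Type) (_ : MeasurableSpace Ω') (P' : Measure Ω') (_ : IsProbabilityMeasure P')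
      (G : T → Ω' → ℝ), IsGaussianProcessWith (fun _ => 0) K G P' ∧
        TendstoInDistribution (fun m ω x => f m x ω) atTop (fun ω x => G x ω) P P' := by
  classical
  have hK := posSemidef_of_tendsto_covariance hint hcov
  refine ⟨EuclideanSpace ℝ T, inferInstance, multivariateGaussian 0 (Matrix.of K), inferInstance,
    fun x ω => ω x, isGaussianProcessWith_eval hK, ?_⟩
  have hmeas : ∀ m, Measurable fun ω => WithLp.toLp 2 fun x => f m x ω := fun m =>
    (MeasurableEquiv.toLp 2 (T → ℝ)).measurable.comp (measurable_pi_lambda _ (hf m))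
  -- Characteristic functions use an inner product, so Lévy's theorem is applied on `EuclideanSpace
  -- ℝ T`; the continuous map `ofLp` then returns to functions on `T`.
  have key : TendstoInDistribution (fun m ω => WithLp.toLp 2 fun x => f m x ω) atTop
      (id : EuclideanSpace ℝ T → EuclideanSpace ℝ T) P (multivariateGaussian 0 (Matrix.of K)) := by
    refine ⟨fun m => (hmeas m).aemeasurable, aemeasurable_id,
      ProbabilityMeasure.tendsto_of_tendsto_charFun fun u => ?_⟩
    have hlim : Tendsto (fun m =>
        Complex.exp (-((∫ ω, (∑ x, u x * f m x ω) ^ 2 ∂P m : ℝ) : ℂ) / 2)) atTop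
        (𝓝 (Complex.exp (-((u.ofLp ⬝ᵥ (Matrix.of K) *ᵥ u.ofLp : ℝ) : ℂ) / 2))) := by
      have hc : Continuous fun v : ℝ => Complex.exp (-(v : ℂ) / 2) := by fun_prop
      exact (hc.tendsto _).comp (tendsto_integral_sum_mul_sq hint hcov u.ofLp)
    have h := (hchar u.ofLp).add hlim
    simp only [sub_add_cancel, zero_add] at h
    simp only [ProbabilityMeasure.coe_mk, Measure.map_id]
    rw [charFun_multivariateGaussian hK, inner_zero_right]
    convert h using 2 with m
    · rw [charFun_apply, integral_map (hmeas m).aemeasurable (by fun_prop)]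
      refine integral_congr_ae (ae_of_all _ fun ω => ?_)
      simp [PiLp.inner_apply, mul_comm]
    · push_cast; ring_nf
  exact key.continuous_comp (PiLp.continuous_ofLp 2 _)

end GaussianLimit

/-! ### Independence from disjoint sets of parameters -/

section Independence

theorem indepFun_of_dependsOn {Ω ι : Type*} [MeasurableSpace Ω] {P : Measure Ω}
    {Θ : ι → Ω → ℝ} (hΘ : iIndepFun Θ P) (hmeas : ∀ i, Measurable (Θ i)) {S T : Finset ι}
    (hST : Disjoint S T) {β γ : Type*} [MeasurableSpace β] [MeasurableSpace γ]
    {F : (ι → ℝ) → β} {G : (ι → ℝ) → γ} (hF : Measurable F) (hG : Measurable G)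
    (hFS : DependsOn F S) (hGT : DependsOn G T) :
    IndepFun (fun ω => F fun i => Θ i ω) (fun ω => G fun i => Θ i ω) P := by
  classical
  -- A tuple on `S` is extended by 0. The default value is irrelevant, since `F` and `G` ignore the
  -- coordinates outside their sets.
  have hext : ∀ S : Finset ι, Measurable fun (y : S → ℝ) (i : ι) =>
      if h : i ∈ S then y ⟨i, h⟩ else 0 := fun S => by
    refine measurable_pi_lambda _ fun i => ?_
    by_cases h : i ∈ S
    · simpa [h] using measurable_pi_apply _
    · simp [h]
  have := (hΘ.indepFun_finset S T hST hmeas).comp (hF.comp (hext S)) (hG.comp (hext T))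
  convert this using 1
  · ext1 ω
    exact hFS fun i hi => by simp [Finset.mem_coe.1 hi]
  · ext1 ω
    exact hGT fun i hi => by simp [Finset.mem_coe.1 hi]

end Independence

/-! ### The central limit theorem applied to the circuit -/

namespace QuantumCircuit

variable {𝒳 : Type*} [Fintype 𝒳] {m : ℕ} (C : QuantumCircuit 𝒳 m)

/-- The observables whose past light cones intersect that of the observable `k`. -/
def neighbors (k : Fin m) : Finset (Fin m) :=
  Finset.univ.filter fun j => ¬ Disjoint (C.pastCone k) (C.pastCone j)

omit [Fintype 𝒳] in
-- A neighbour of `k` shares with it some parameter of 𝒩_k, so it lies in the future cone of one of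
-- at most |𝒩| parameters.
theorem card_neighbors_le (k : Fin m) : (C.neighbors k).card ≤ C.maxPast * C.maxFuture := by
  have hsub : C.neighbors k ⊆ (C.pastCone k).biUnion C.futureCone := fun j hj => by
    obtain ⟨i, hik, hij⟩ := Finset.not_disjoint_iff.1 (Finset.mem_filter.1 hj).2
    exact Finset.mem_biUnion.2 ⟨i, hik, Finset.mem_filter.2 ⟨Finset.mem_univ _, hij⟩⟩
  refine (Finset.card_le_card hsub).trans
    ((Finset.card_biUnion_le_card_mul _ _ C.maxFuture fun i _ => ?_).trans
      (Nat.mul_le_mul_right _ ?_))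
  · exact Finset.le_sup (f := fun i => (C.futureCone i).card) (Finset.mem_univ i)
  · exact Finset.le_sup (f := fun k => (C.pastCone k).card) (Finset.mem_univ k)

omit [Fintype 𝒳] in
theorem measurable_localOutput (k : Fin m) (x : 𝒳) :
    Measurable fun θ => C.localOutput k θ x :=
  (C.continuous_localOutput k x).measurable

omit [Fintype 𝒳] in
theorem measurable_model (N : ℝ) (x : 𝒳) : Measurable fun θ => C.model N θ x := by
  simp_rw [model_eq_sum]
  exact (Finset.measurable_sum _ fun k _ => C.measurable_localOutput k x).const_mul _

omit [Fintype 𝒳] in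
theorem abs_model_le (N : ℝ) (θ : C.Param → ℝ) (x : 𝒳) : |C.model N θ x| ≤ |1 / N| * m := by
  rw [model_eq_sum, abs_mul]
  refine mul_le_mul_of_nonneg_left ((Finset.abs_sum_le_sum_abs _ _).trans
    ((Finset.sum_le_sum fun k _ => C.abs_localOutput_le_one k θ x).trans ?_)) (abs_nonneg _)
  simp

/-- The contribution of the observable `k` to a linear combination of the values of the model. -/
noncomputable def localCombination (N : ℝ) (u : 𝒳 → ℝ) (k : Fin m) (θ : C.Param → ℝ) : ℝ :=
  (1 / N) * ∑ x, u x * C.localOutput k θ x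

theorem sum_localCombination (N : ℝ) (u : 𝒳 → ℝ) (θ : C.Param → ℝ) :
    ∑ k, C.localCombination N u k θ = ∑ x, u x * C.model N θ x := by
  simp_rw [localCombination, model_eq_sum, ← Finset.mul_sum]
  rw [Finset.sum_comm, Finset.mul_sum]
  refine Finset.sum_congr rfl fun x _ => ?_
  rw [← Finset.mul_sum]; ring

theorem measurable_localCombination (N : ℝ) (u : 𝒳 → ℝ) (k : Fin m) :
    Measurable (C.localCombination N u k) :=
  (Finset.measurable_sum _ fun x _ => (C.measurable_localOutput k x).const_mul _).const_mul _

theorem dependsOn_localCombination (N : ℝ) (u : 𝒳 → ℝ) (k : Fin m) :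
    DependsOn (C.localCombination N u k) (C.pastCone k) := fun θ θ' h => by
  simp only [localCombination, C.localOutput_congr k (θ := θ) (θ' := θ') fun i hi => h i hi]

theorem abs_localCombination_le {N : ℝ} (hN : 0 < N) (u : 𝒳 → ℝ) (k : Fin m)
    (θ : C.Param → ℝ) : |C.localCombination N u k θ| ≤ (∑ x, |u x|) / N := by
  rw [localCombination, abs_mul, abs_of_pos (one_div_pos.2 hN), div_eq_inv_mul, div_eq_inv_mul,
    mul_one]
  refine mul_le_mul_of_nonneg_left ((Finset.abs_sum_le_sum_abs _ _).trans
    (Finset.sum_le_sum fun x _ => ?_)) (inv_nonneg.2 hN.le)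
  rw [abs_mul]
  exact mul_le_of_le_one_right (abs_nonneg _) (C.abs_localOutput_le_one k θ x)

/-- At initialization, linear combinations of the values of the model are approximately Gaussian,
with an error controlled by the sizes of the light cones. -/
theorem norm_charFun_model_sub_le {N : ℝ} (hN : 0 < N) {Ω : Type*} [MeasurableSpace Ω]
    {P : Measure Ω} [IsProbabilityMeasure P] {Θ : C.Param → Ω → ℝ}
    (hΘ_meas : ∀ i, Measurable (Θ i)) (hΘ_indep : iIndepFun Θ P)
    (hmean : ∀ (k : Fin m) (x : 𝒳), ∫ ω, C.localOutput k (fun i => Θ i ω) x ∂P = 0)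
    (u : 𝒳 → ℝ) :
    ‖∫ ω, Complex.exp (Complex.I * (∑ x, u x * C.model N (fun i => Θ i ω) x : ℝ)) ∂P -
      Complex.exp (-((∫ ω, (∑ x, u x * C.model N (fun i => Θ i ω) x) ^ 2 ∂P : ℝ) : ℂ) / 2)‖ ≤
        7 * (∑ x, |u x|) ^ 3 *
          (m * (C.maxFuture : ℝ) ^ 2 * (C.maxPast : ℝ) ^ 2 / N ^ 3) := by
  have hΘ : Measurable fun ω i => Θ i ω := measurable_pi_lambda _ hΘ_meas
  have hmean' : ∀ k, ∫ ω, C.localCombination N u k (fun i => Θ i ω) ∂P = 0 := fun k => by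
    simp_rw [localCombination]
    rw [integral_const_mul, integral_finsetSum]
    · simp_rw [integral_const_mul, hmean, mul_zero, Finset.sum_const_zero, mul_zero]
    · exact fun x _ => (Integrable.of_bound
        ((C.measurable_localOutput k x).comp hΘ).aestronglyMeasurable 1
        (ae_of_all _ fun ω => C.abs_localOutput_le_one k _ x)).const_mul _
  have hdisj : ∀ k, ∀ j ∉ C.neighbors k, Disjoint (C.pastCone k) (C.pastCone j) := fun k j hj => by
    simpa [neighbors] using hj
  -- With these `B` and `D`, the error 7 m D² B³ is the growth quantity times 7 (Σ |u_x|)³.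
  have h := norm_charFun_sum_sub_le (P := P)
    (X := fun k ω => C.localCombination N u k fun i => Θ i ω) (A := C.neighbors)
    (B := (∑ x, |u x|) / N) (D := C.maxPast * C.maxFuture)
    (fun k => (C.measurable_localCombination N u k).comp hΘ) (by positivity)
    (fun k ω => C.abs_localCombination_le hN u k _) hmean' C.card_neighbors_le
    (fun k j hj => indepFun_of_dependsOn hΘ_indep hΘ_meas (hdisj k j hj)
      (C.measurable_localCombination N u k) (C.measurable_localCombination N u j)
      (C.dependsOn_localCombination N u k) (C.dependsOn_localCombination N u j))
    (fun k j => by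
      -- The pair depends on the two past cones, the remaining sum on the cones of the common
      -- non-neighbours; these parameter sets are disjoint by the definition of neighbours.
      refine indepFun_of_dependsOn hΘ_indep hΘ_meas (S := C.pastCone k ∪ C.pastCone j)
        (T := (C.neighbors k ∪ C.neighbors j)ᶜ.biUnion C.pastCone)
        (F := fun θ => (C.localCombination N u k θ, C.localCombination N u j θ))
        (G := fun θ => ∑ l ∈ (C.neighbors k ∪ C.neighbors j)ᶜ, C.localCombination N u l θ)
        ?_ ((C.measurable_localCombination N u k).prodMk (C.measurable_localCombination N u j))
        (Finset.measurable_sum _ fun l _ => C.measurable_localCombination N u l) ?_ ?_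
      · rw [Finset.disjoint_biUnion_right]
        intro l hl
        rw [Finset.mem_compl, Finset.mem_union, not_or] at hl
        exact Finset.disjoint_union_left.2 ⟨hdisj k l hl.1, hdisj j l hl.2⟩
      · intro θ θ' hθ
        exact Prod.ext
          (C.dependsOn_localCombination N u k fun i hi => hθ i (by simp [Finset.mem_coe.1 hi]))
          (C.dependsOn_localCombination N u j fun i hi => hθ i (by simp [Finset.mem_coe.1 hi]))
      · intro θ θ' hθ
        exact Finset.sum_congr rfl fun l hl => C.dependsOn_localCombination N u l fun i hi =>
          hθ i (Finset.mem_coe.2 (Finset.mem_biUnion.2 ⟨l, hl, hi⟩)))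
  simp only [sum_localCombination, Fintype.card_fin] at h
  refine h.trans_eq ?_
  push_cast
  rw [div_pow]
  ring

end QuantumCircuit

theorem theorem3p6 {d : ℕ} (𝒳 : Finset (EuclideanSpace ℝ (Fin d)))
    (C : ∀ m : ℕ, QuantumCircuit 𝒳 m)
    (N : ℕ → ℝ) (hN : ∀ m, 0 < N m)
    {Ω : ℕ → Type*} [∀ m, MeasurableSpace (Ω m)]
    (P : ∀ m, Measure (Ω m)) [∀ m, IsProbabilityMeasure (P m)]
    (Θ : ∀ m, (C m).Param → Ω m → ℝ)
    (hΘ_meas : ∀ m i, Measurable (Θ m i))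
    (hΘ_indep : ∀ m, iIndepFun (Θ m) (P m))
    (hmean : ∀ (m : ℕ) (k : Fin m) (x : 𝒳),
      ∫ ω, (C m).localOutput k (fun i => Θ m i ω) x ∂(P m) = 0)
    (𝒦 : 𝒳 → 𝒳 → ℝ) (h𝒦 : ∀ x, 0 < 𝒦 x x)
    (hcov : Tendsto (fun m => ⨆ p : 𝒳 × 𝒳,
      |∫ ω, (C m).model (N m) (fun i => Θ m i ω) p.1 * (C m).model (N m) (fun i => Θ m i ω) p.2 ∂(P m)
        - 𝒦 p.1 p.2|) atTop (𝓝 0))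
    (hgrowth : Tendsto (fun m : ℕ =>
      (m : ℝ) * ((C m).maxFuture : ℝ) ^ 2 * ((C m).maxPast : ℝ) ^ 2 / N m ^ 3) atTop (𝓝 0)) :
    ∃ (Ω' : Type) (_ : MeasurableSpace Ω') (P' : Measure Ω') (_ : IsProbabilityMeasure P')
      (G : 𝒳 → Ω' → ℝ),
      IsGaussianProcessWith (fun _ => 0) 𝒦 G P' ∧
      TendstoInDistribution
        (fun (m : ℕ) (ω : Ω m) (x : 𝒳) => (C m).model (N m) (fun i => Θ m i ω) x) atTop
        (fun ω x => G x ω) P P' := by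
  have hmeas : ∀ m x, Measurable fun ω => (C m).model (N m) (fun i => Θ m i ω) x := fun m x =>
    ((C m).measurable_model (N m) x).comp (measurable_pi_lambda _ (hΘ_meas m))
  refine exists_gaussianProcess_tendstoInDistribution
    (f := fun m x ω => (C m).model (N m) (fun i => Θ m i ω) x) hmeas (fun m x y => ?_)
    (fun x y => ?_) fun u => ?_
  · refine Integrable.of_bound ((hmeas m x).mul (hmeas m y)).aestronglyMeasurable
      (|1 / N m| * m * (|1 / N m| * m)) (ae_of_all _ fun ω => ?_)
    rw [norm_mul]
    exact mul_le_mul ((C m).abs_model_le _ _ x) ((C m).abs_model_le _ _ y) (norm_nonneg _)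
      (by positivity)
  · rw [tendsto_iff_norm_sub_tendsto_zero]
    -- Each pair is dominated by the supremum, which is a genuine one because 𝒳 is finite.
    refine squeeze_zero (fun m => norm_nonneg _) (fun m => ?_) hcov
    exact le_ciSup (f := fun p : 𝒳 × 𝒳 => |∫ ω, (C m).model (N m) (fun i => Θ m i ω) p.1 *
      (C m).model (N m) (fun i => Θ m i ω) p.2 ∂(P m) - 𝒦 p.1 p.2|)
      (Set.finite_range _).bddAbove (x, y)
  · refine squeeze_zero_norm (fun m => (C m).norm_charFun_model_sub_le (hN m) (hΘ_meas m)
      (hΘ_indep m) (hmean m) u) ?_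
    simpa using hgrowth.const_mul (7 * (∑ x, |u x|) ^ 3)
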